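/- Let $n\ge 1$, let $\omega\subset\mathbb{R}^{n-1}$ be open, bounded and connected (for instance a bounded Lipschitz domain), and let $f\in L^2(\omega)$. For $\ell>0$ put $\Omega_\ell=(-\ell,\ell)\times\omega\subset\mathbb{R}^n$ and write $x=(x_1,x')$, $(g\otimes h)(x)=g(x_1)h(x')$; $\nabla'$ is the gradient in $x'$. Let $u_\infty\in H^1_0(\omega)$ be the weak solution of $-\Delta' u_\infty=f$ in $\omega$, $u_\infty=0$ on $\partial\omega$, that is, $$(\nabla' u_\infty,\nabla' v)_{L^2(\omega)}=(f,v)_{L^2(\omega)}\quad\text{for all } v\in H^1_0(\omega),$$ and let $u_\ell\in H^1_0(\Omega_\ell)$ be the weak solution of $-\Delta u_\ell=1\otimes f$ in $\Omega_\ell$, $u_\ell=0$ on $\partial\Omega_\ell$, that is, $(\nabla u_\ell,\nabla v)_{L^2(\Omega_\ell)}=(1\otimes f,v)_{L^2(\Omega_\ell)}$ for all $v\in H^1_0(\Omega_\ell)$. Put $$\lambda_\infty=\frac{\|\nabla' u_\infty\|_{L^2(\omega)}}{\|u_\infty\|_{L^2(\omega)}},\qquad \psi_\ell(a,x_1)=1-\frac{\cosh(a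 x_1)}{\cosh(a\ell)},\qquad \lambda_1=\inf_{v\in H^1_0(\omega)\setminus\{0\}}\frac{\|\nabla' v\|_{L^2(\omega)}}{\|v\|_{L^2(\omega)}}$$ (if $u_\infty=0$, then $\lambda_\infty$ is read as $0$; in the degenerate case $n=1$, where $\lambda_1=0$, the term $1/\lambda_1$ is read as $0$). Then for every $\ell>0$ the difference $u_\ell-\psi_\ell(\lambda_\infty,\cdot)\otimes u_\infty$ belongs to $H^1_0(\Omega_\ell)$ and $$\left\|\nabla\left(u_\ell-\psi_\ell(\lambda_\infty,\cdot)\otimes u_\infty\right)\right\|_{L^2(\Omega_\ell)}^2\le 4\left(\|u_\infty\|_{L^2(\omega)}^2+\left(\frac1{\lambda_1}+6\ell e^{-2\lambda_1\ell}\right)\|\nabla' u_\infty\|_{L^2(\omega)}^2\right).$$ If $u_\infty\ne 0$, the right-hand side does not tend to $0$ as $\ell\to\infty$, so this bound does not give convergence on the whole cylinder $\Omega_\ell$. -/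

import Mathlib

open MeasureTheory Filter Topology

noncomputable section

/-- Euclidean space of dimension `d`. -/
abbrev Euc (d : ℕ) : Type := EuclideanSpace ℝ (Fin d)

/-- Test functions on `U`: smooth functions whose support is a compact subset of `U`. -/
def IsTestFunction {d : ℕ} (U : Set (Euc d)) (φ : Euc d → ℝ) : Prop :=
  ContDiff ℝ (⊤ : ℕ∞) φ ∧ HasCompactSupport φ ∧ tsupport φ ⊆ U

/-- The `L²(U)`-norm of a (scalar or vector valued) function. -/
def normL2 {d : ℕ} {F : Type*} [NormedAddCommGroup F] (U : Set (Euc d)) (g : Euc d → F) : ℝ :=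
  (eLpNorm g 2 (volume.restrict U)).toReal

/-- `G ∈ L²(U)` is a weak gradient of `u` on `U`:
`∫_U u ∇φ = - ∫_U φ G` for all test functions `φ` on `U`. -/
def IsWeakGradient {d : ℕ} (U : Set (Euc d)) (u : Euc d → ℝ) (G : Euc d → Euc d) : Prop :=
  MemLp G 2 (volume.restrict U) ∧
    ∀ φ : Euc d → ℝ, IsTestFunction U φ →
      ∫ x in U, u x • gradient φ x = - ∫ x in U, φ x • G x

/-- The Sobolev space `H¹(U)`. -/
def MemH1 {d : ℕ} (U : Set (Euc d)) (u : Euc d → ℝ) : Prop :=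
  MemLp u 2 (volume.restrict U) ∧ ∃ G : Euc d → Euc d, IsWeakGradient U u G

open Classical in
/-- The weak gradient of `u ∈ H¹(U)`; it is determined almost everywhere on an open `U`.
(The value is `0` if `u` has no square integrable weak gradient.) -/
def weakGrad {d : ℕ} (U : Set (Euc d)) (u : Euc d → ℝ) : Euc d → Euc d :=
  if h : ∃ G : Euc d → Euc d, IsWeakGradient U u G then h.choose else 0

/-- The Sobolev space `H¹₀(U)`: the closure of the test functions in `H¹(U)`. -/
def MemH10 {d : ℕ} (U : Set (Euc d)) (u : Euc d → ℝ) : Prop :=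
  MemH1 U u ∧ ∃ φ : ℕ → Euc d → ℝ, (∀ k, IsTestFunction U (φ k)) ∧
    Tendsto (fun k => eLpNorm (fun x => u x - φ k x) 2 (volume.restrict U)) atTop (𝓝 0) ∧
    Tendsto (fun k => eLpNorm (fun x => weakGrad U u x - gradient (φ k) x) 2
      (volume.restrict U)) atTop (𝓝 0)

/-- `u` is the weak solution of `-Δu = F` in `U`, `u = 0` on `∂U`:
`u ∈ H¹₀(U)` and `(∇u, ∇v)_{L²(U)} = (F, v)_{L²(U)}` for all `v ∈ H¹₀(U)`. -/
def IsDirichletSolution {d : ℕ} (U : Set (Euc d)) (F u : Euc d → ℝ) : Prop :=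
  MemH10 U u ∧ ∀ v : Euc d → ℝ, MemH10 U v →
    ∫ x in U, inner ℝ (weakGrad U u x) (weakGrad U v x) = ∫ x in U, F x * v x

/-- The number `λ₁ = inf ‖∇v‖ / ‖v‖` over all nonzero `v ∈ H¹₀(U)`. -/
def lambdaOne {d : ℕ} (U : Set (Euc d)) : ℝ :=
  sInf {r : ℝ | ∃ v : Euc d → ℝ, MemH10 U v ∧ ¬ (v =ᵐ[volume.restrict U] 0) ∧
    r = normL2 U (weakGrad U v) / normL2 U v}

/-- The projection `x = (x₁, x') ↦ x'`. -/
def crossPart {m : ℕ} (x : Euc (m + 1)) : Euc m :=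
  WithLp.toLp 2 (fun i : Fin m => x i.succ)

/-- The cylinder `Ω_ℓ = (-ℓ, ℓ) × ω`. -/
def longCylinder {m : ℕ} (ℓ : ℝ) (ω : Set (Euc m)) : Set (Euc (m + 1)) :=
  {x | x 0 ∈ Set.Ioo (-ℓ) ℓ ∧ crossPart x ∈ ω}

/-- The elementary tensor `(g ⊗ h)(x) = g(x₁) h(x')`. -/
def tensor {m : ℕ} (g : ℝ → ℝ) (h : Euc m → ℝ) : Euc (m + 1) → ℝ :=
  fun x => g (x 0) * h (crossPart x)

/-- The function `ψ_ℓ(a, t) = 1 - cosh(a t) / cosh(a ℓ)`. -/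
def psi (ℓ a t : ℝ) : ℝ := 1 - Real.cosh (a * t) / Real.cosh (a * ℓ)

/-- The number `λ_∞ = ‖∇'u‖_{L²(ω)} / ‖u‖_{L²(ω)}`. -/
def lambdaInf {m : ℕ} (ω : Set (Euc m)) (u : Euc m → ℝ) : ℝ :=
  normL2 ω (weakGrad ω u) / normL2 ω u

end

/-! Write `u` for the cross-sectional solution, `ψ = psi ℓ a` and `w = u_ℓ - ψ ⊗ u`. The profile `ψ`
vanishes at `±ℓ`, so `w` lies in `H¹₀` of the cylinder (`memH10_tensor`).

Integrating the cross-sectional equation along the axis shows that the field `(0, ∇'u)` has the same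
products with gradients of test functions as `∇u_ℓ` (`IsDirichletSolution.integral_longCylinder`).
Put `V = ∇((1 - ψ) ⊗ u)`. Then `∇w - V = ∇u_ℓ - (0, ∇'u)` is orthogonal to all gradients of `H¹₀`
functions, in particular to `∇w`. Thus `∇w` is an orthogonal projection of `V`, and `‖∇w‖ ≤ ‖V‖`
(`normL2_weakGrad_sub_tensor_psi_sq_le`).

Since `1 - ψ = cosh(at)/cosh(aℓ)`, Fubini gives `‖V‖² = a² S ‖u‖² + C ‖∇'u‖²`, with `S` and `C` the
integrals of the squares of `sinh(at)/cosh(aℓ)` and `cosh(at)/cosh(aℓ)`. For `a = λ_∞` one has `a‖u‖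
= ‖∇'u‖`, so `‖V‖² = (S + C)‖∇'u‖²`. Finally `S + C = 2 tanh(aℓ)/a ≤ 2/λ₁` when `λ₁ > 0` and `u ≠
0`, while `S + C ≤ 4ℓ` always. The second bound settles `λ₁ = 0`, so no Poincaré inequality is
needed. The claimed bound stays above `4‖u‖²`, whence the last assertion. -/

noncomputable section

/-! ### Weak gradients and the space `H¹₀`. -/

theorem gradient_eq_iff_inner {d : ℕ} (φ : Euc d → ℝ) (x v : Euc d) :
    inner ℝ (gradient φ x) v = fderiv ℝ φ x v := by
  simp [gradient]

/-- By Hölder, `L²` convergence of one factor gives `L¹` convergence of the product. Every passage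
from test functions to `H¹₀` rests on this. -/
theorem tendsto_integral_bilin {α F G H : Type*} [MeasurableSpace α] {μ : Measure α}
    [NormedAddCommGroup F] [NormedSpace ℝ F] [NormedAddCommGroup G] [NormedSpace ℝ G]
    [NormedAddCommGroup H] [NormedSpace ℝ H] (B : F →L[ℝ] G →L[ℝ] H)
    {f : α → F} {fs : ℕ → α → F} {g : α → G} (hf : MemLp f 2 μ) (hfs : ∀ k, MemLp (fs k) 2 μ)
    (hg : MemLp g 2 μ)
    (h : Tendsto (fun k => eLpNorm (fun x => f x - fs k x) 2 μ) atTop (𝓝 0)) :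
    Tendsto (fun k => ∫ x, B (fs k x) (g x) ∂μ) atTop (𝓝 (∫ x, B (f x) (g x) ∂μ)) := by
  have key : ∀ k, eLpNorm (fun x => B (f x - fs k x) (g x)) 1 μ
      ≤ ‖B‖₊ * eLpNorm (fun x => f x - fs k x) 2 μ * eLpNorm g 2 μ := by
    intro k
    refine eLpNorm_le_eLpNorm_mul_eLpNorm_of_nnnorm (p := 2) (q := 2) (r := 1)
      (hf.1.sub (hfs k).1) hg.1 (fun a b => B a b) ‖B‖₊ ?_
    exact Eventually.of_forall fun x => B.le_opNorm₂ _ _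
  have hint : ∀ {a : α → F}, MemLp a 2 μ → Integrable (fun x => B (a x) (g x)) μ := fun ha =>
    memLp_one_iff_integrable.1 (B.memLp_of_bilin (p := 2) (q := 2) 1 ha hg)
  refine tendsto_integral_of_L1' _ (hint hf).1 (Eventually.of_forall fun k => hint (hfs k)) ?_
  have hlim : Tendsto (fun k => ‖B‖₊ * eLpNorm (fun x => f x - fs k x) 2 μ * eLpNorm g 2 μ)
      atTop (𝓝 0) := by
    have h1 := ENNReal.Tendsto.const_mul (a := (‖B‖₊ : ENNReal)) h (Or.inr ENNReal.coe_ne_top)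
    have h2 := ENNReal.Tendsto.mul_const (b := eLpNorm g 2 μ) h1 (Or.inr hg.2.ne)
    simpa using h2
  refine tendsto_of_tendsto_of_tendsto_of_le_of_le tendsto_const_nhds hlim
    (fun _ => zero_le) fun k => ?_
  refine le_trans (le_of_eq ?_) (key k)
  rw [← eLpNorm_neg]
  congr 1
  ext x
  simp

variable {d : ℕ} {U : Set (Euc d)}

theorem IsTestFunction.continuous_gradient {φ : Euc d → ℝ} (h : IsTestFunction U φ) :
    Continuous (gradient φ) := by
  have := h.1.continuous_fderiv (by simp)
  exact (InnerProductSpace.toDual ℝ (Euc d)).symm.continuous.comp this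

theorem IsTestFunction.hasCompactSupport_gradient {φ : Euc d → ℝ} (h : IsTestFunction U φ) :
    HasCompactSupport (gradient φ) :=
  (h.2.1.fderiv (𝕜 := ℝ)).comp_left (g := (InnerProductSpace.toDual ℝ (Euc d)).symm) (map_zero _)

theorem IsTestFunction.memLp {φ : Euc d → ℝ} (h : IsTestFunction U φ) {p : ENNReal} :
    MemLp φ p (volume.restrict U) :=
  (h.1.continuous.memLp_of_hasCompactSupport h.2.1).restrict U

theorem IsTestFunction.memLp_gradient {φ : Euc d → ℝ} (h : IsTestFunction U φ) {p : ENNReal} :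
    MemLp (gradient φ) p (volume.restrict U) :=
  (h.continuous_gradient.memLp_of_hasCompactSupport h.hasCompactSupport_gradient).restrict U

theorem IsTestFunction.eq_zero {φ : Euc d → ℝ} (h : IsTestFunction U φ) {x : Euc d}
    (hx : x ∉ U) : φ x = 0 :=
  image_eq_zero_of_notMem_tsupport fun h' => hx (h.2.2 h')

theorem IsTestFunction.integral_smul_gradient {φ η : Euc d → ℝ} (hφ : IsTestFunction U φ)
    (hη : IsTestFunction U η) :
    ∫ x in U, φ x • gradient η x = - ∫ x in U, η x • gradient φ x := by
  rw [setIntegral_eq_integral_of_forall_compl_eq_zero fun x hx => by rw [hφ.eq_zero hx, zero_smul],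
    setIntegral_eq_integral_of_forall_compl_eq_zero fun x hx => by rw [hη.eq_zero hx, zero_smul]]
  have h1 : ∀ {a b : Euc d → ℝ}, IsTestFunction U a → IsTestFunction U b →
      Integrable (fun x => a x • gradient b x) := fun ha hb =>
    (ha.1.continuous.smul hb.continuous_gradient).integrable_of_hasCompactSupport ha.2.1.smul_right
  -- Pairing with a fixed vector `v` reduces the claim to scalar integration by parts in the
  -- direction `v`, on the whole space because test functions vanish off `U`.
  refine ext_inner_right ℝ fun v => ?_
  have h2 : ∀ {a b : Euc d → ℝ}, IsTestFunction U a → IsTestFunction U b →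
      inner ℝ (∫ x, a x • gradient b x) v = ∫ x, a x * fderiv ℝ b x v := by
    intro a b ha hb
    rw [real_inner_comm, ← integral_inner (h1 ha hb)]
    refine integral_congr_ae (Eventually.of_forall fun x => ?_)
    simp only
    rw [inner_smul_right, real_inner_comm, gradient_eq_iff_inner]
  have h3 : ∀ {a b : Euc d → ℝ}, IsTestFunction U a → IsTestFunction U b →
      Integrable (fun x => a x * fderiv ℝ b x v) := by
    intro a b ha hb
    refine ((h1 ha hb).const_inner v).congr (Eventually.of_forall fun x => ?_)
    simp only
    rw [inner_smul_right, real_inner_comm, gradient_eq_iff_inner]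
  rw [inner_neg_left, h2 hφ hη, h2 hη hφ, integral_mul_fderiv_eq_neg_fderiv_mul_of_integrable]
  · congr 2
    ext x
    ring
  · simpa [mul_comm] using h3 hη hφ
  · exact h3 hφ hη
  · exact (hφ.1.continuous.mul hη.1.continuous).integrable_of_hasCompactSupport hφ.2.1.mul_right
  · exact fun x _ => (hφ.1.differentiable (by simp)).differentiableAt
  · exact fun x _ => (hη.1.differentiable (by simp)).differentiableAt

/-- The fundamental lemma of the calculus of variations, applied to `G - G'`. It makes the arbitrary
choice in `weakGrad` harmless. -/
theorem IsWeakGradient.ae_eq (hU : IsOpen U) {u : Euc d → ℝ} {G G' : Euc d → Euc d}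
    (h : IsWeakGradient U u G) (h' : IsWeakGradient U u G') :
    G =ᵐ[volume.restrict U] G' := by
  have hl : LocallyIntegrableOn (fun x => G x - G' x) U := by
    have := (h.1.sub h'.1).locallyIntegrable (by norm_num)
    exact locallyIntegrableOn_of_locallyIntegrable_restrict this
  have := hU.ae_eq_zero_of_integral_contDiff_smul_eq_zero (μ := volume) hl ?_
  · rw [Filter.EventuallyEq, ae_restrict_iff' hU.measurableSet]
    filter_upwards [this] with x hx hxU
    exact sub_eq_zero.1 (hx hxU)
  · intro φ h1 h2 h3
    have hφ : IsTestFunction U φ := ⟨h1, h2, h3⟩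
    rw [← setIntegral_eq_integral_of_forall_compl_eq_zero (s := U)
      fun x hx => by rw [hφ.eq_zero hx, zero_smul]]
    have hi : ∀ {A : Euc d → Euc d}, MemLp A 2 (volume.restrict U) →
        Integrable (fun x => φ x • A x) (volume.restrict U) := fun hA =>
      memLp_one_iff_integrable.1 (hA.smul (hφ.memLp (p := 2)))
    simp_rw [smul_sub]
    rw [integral_sub (hi h.1) (hi h'.1)]
    have e1 := h.2 φ hφ
    have e2 := h'.2 φ hφ
    rw [e1] at e2
    rw [neg_injective e2, sub_self]

theorem IsWeakGradient.weakGrad_spec {u : Euc d → ℝ} {G : Euc d → Euc d}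
    (h : IsWeakGradient U u G) : IsWeakGradient U u (weakGrad U u) := by
  have : ∃ G, IsWeakGradient U u G := ⟨G, h⟩
  unfold weakGrad
  rw [dif_pos this]
  exact this.choose_spec

theorem IsWeakGradient.weakGrad_ae_eq (hU : IsOpen U) {u : Euc d → ℝ} {G : Euc d → Euc d}
    (h : IsWeakGradient U u G) : weakGrad U u =ᵐ[volume.restrict U] G :=
  h.weakGrad_spec.ae_eq hU h

theorem MemH1.isWeakGradient {u : Euc d → ℝ} (h : MemH1 U u) :
    IsWeakGradient U u (weakGrad U u) :=
  h.2.choose_spec.weakGrad_spec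

/-- Both sides of the integration by parts formula for `φ k` converge when tested against a fixed
`η`. -/
theorem IsWeakGradient.of_tendsto {u : Euc d → ℝ} {G : Euc d → Euc d}
    {φ : ℕ → Euc d → ℝ} (hu : MemLp u 2 (volume.restrict U)) (hG : MemLp G 2 (volume.restrict U))
    (hφ : ∀ k, IsTestFunction U (φ k))
    (h1 : Tendsto (fun k => eLpNorm (fun x => u x - φ k x) 2 (volume.restrict U)) atTop (𝓝 0))
    (h2 : Tendsto (fun k => eLpNorm (fun x => G x - gradient (φ k) x) 2
      (volume.restrict U)) atTop (𝓝 0)) : IsWeakGradient U u G := by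
  refine ⟨hG, fun η hη => ?_⟩
  have t1 := tendsto_integral_bilin (ContinuousLinearMap.lsmul ℝ ℝ) hu
    (fun k => (hφ k).memLp) hη.memLp_gradient h1
  have t2 := tendsto_integral_bilin (ContinuousLinearMap.lsmul ℝ ℝ (E := Euc d)).flip hG
    (fun k => (hφ k).memLp_gradient) hη.memLp h2
  simp only [ContinuousLinearMap.lsmul_apply, ContinuousLinearMap.flip_apply] at t1 t2
  refine tendsto_nhds_unique t1 ?_
  simpa only [(hφ _).integral_smul_gradient hη] using t2.neg

/-- The working criterion for `H¹₀`: the limit `G` of the gradients need not be known beforehand to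
be a weak gradient. -/
theorem MemH10.of_tendsto (hU : IsOpen U) {u : Euc d → ℝ} {G : Euc d → Euc d}
    {φ : ℕ → Euc d → ℝ} (hu : MemLp u 2 (volume.restrict U)) (hG : MemLp G 2 (volume.restrict U))
    (hφ : ∀ k, IsTestFunction U (φ k))
    (h1 : Tendsto (fun k => eLpNorm (fun x => u x - φ k x) 2 (volume.restrict U)) atTop (𝓝 0))
    (h2 : Tendsto (fun k => eLpNorm (fun x => G x - gradient (φ k) x) 2
      (volume.restrict U)) atTop (𝓝 0)) :
    MemH10 U u ∧ weakGrad U u =ᵐ[volume.restrict U] G := by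
  have hw := IsWeakGradient.of_tendsto hu hG hφ h1 h2
  have he := hw.weakGrad_ae_eq hU
  refine ⟨⟨⟨hu, G, hw⟩, φ, hφ, h1, h2.congr fun k => ?_⟩, he⟩
  refine eLpNorm_congr_ae ?_
  filter_upwards [he] with x hx
  rw [hx]

theorem IsTestFunction.memH10 (hU : IsOpen U) {φ : Euc d → ℝ} (h : IsTestFunction U φ) :
    MemH10 U φ ∧ weakGrad U φ =ᵐ[volume.restrict U] gradient φ :=
  MemH10.of_tendsto hU h.memLp h.memLp_gradient (fun _ => h) (by simp) (by simp)

theorem gradient_sub_apply {φ η : Euc d → ℝ} {x : Euc d} (hφ : DifferentiableAt ℝ φ x)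
    (hη : DifferentiableAt ℝ η x) : gradient (φ - η) x = gradient φ x - gradient η x := by
  simp [gradient, fderiv_sub hφ hη]

theorem IsTestFunction.sub {φ η : Euc d → ℝ} (hφ : IsTestFunction U φ)
    (hη : IsTestFunction U η) : IsTestFunction U (φ - η) :=
  ⟨hφ.1.sub hη.1, hφ.2.1.sub hη.2.1,
    (tsupport_sub φ η).trans (Set.union_subset hφ.2.2 hη.2.2)⟩

theorem tendsto_eLpNorm_sub_sub {α F : Type*} [MeasurableSpace α] [NormedAddCommGroup F]
    {μ : Measure α} {f g : α → F} {fs gs : ℕ → α → F} (hf : MemLp f 2 μ) (hg : MemLp g 2 μ)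
    (hfs : ∀ k, MemLp (fs k) 2 μ) (hgs : ∀ k, MemLp (gs k) 2 μ)
    (h1 : Tendsto (fun k => eLpNorm (fun x => f x - fs k x) 2 μ) atTop (𝓝 0))
    (h2 : Tendsto (fun k => eLpNorm (fun x => g x - gs k x) 2 μ) atTop (𝓝 0)) :
    Tendsto (fun k => eLpNorm (fun x => (f x - g x) - (fs k x - gs k x)) 2 μ) atTop (𝓝 0) := by
  have h3 := h1.add h2
  rw [add_zero] at h3
  refine tendsto_of_tendsto_of_tendsto_of_le_of_le tendsto_const_nhds h3
    (fun _ => zero_le) fun k => ?_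
  refine le_trans (le_of_eq ?_) (eLpNorm_sub_le (hf.1.sub (hfs k).1) (hg.1.sub (hgs k).1)
    one_le_two)
  congr 1
  ext x
  simp only [Pi.sub_apply]
  abel

theorem MemH10.sub (hU : IsOpen U) {u v : Euc d → ℝ} (hu : MemH10 U u) (hv : MemH10 U v) :
    MemH10 U (u - v) ∧ weakGrad U (u - v) =ᵐ[volume.restrict U]
      fun x => weakGrad U u x - weakGrad U v x := by
  obtain ⟨hu1, φ, hφ, a1, a2⟩ := hu
  obtain ⟨hv1, η, hη, b1, b2⟩ := hv
  have gu := hu1.isWeakGradient.1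
  have gv := hv1.isWeakGradient.1
  refine MemH10.of_tendsto hU (hu1.1.sub hv1.1) (gu.sub gv) (fun k => (hφ k).sub (hη k)) ?_ ?_
  · exact tendsto_eLpNorm_sub_sub hu1.1 hv1.1 (fun k => (hφ k).memLp) (fun k => (hη k).memLp) a1 b1
  · refine (tendsto_eLpNorm_sub_sub gu gv (fun k => (hφ k).memLp_gradient)
      (fun k => (hη k).memLp_gradient) a2 b2).congr fun k => ?_
    congr 1
    ext1 x
    rw [gradient_sub_apply ((hφ k).1.differentiable (by simp)).differentiableAt
      ((hη k).1.differentiable (by simp)).differentiableAt]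

/-- A vector field that is orthogonal to the gradients of all test functions is orthogonal to the
weak gradients of all elements of `H¹₀`. -/
theorem MemH10.integral_inner_eq_zero {w : Euc d → ℝ} (hw : MemH10 U w) {A : Euc d → Euc d}
    (hA : MemLp A 2 (volume.restrict U))
    (h : ∀ φ, IsTestFunction U φ → ∫ x in U, inner ℝ (gradient φ x) (A x) = 0) :
    ∫ x in U, inner ℝ (weakGrad U w x) (A x) = 0 := by
  obtain ⟨hw1, φ, hφ, -, a2⟩ := hw
  have t : Tendsto (fun k => ∫ x in U, inner ℝ (gradient (φ k) x) (A x)) atTop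
      (𝓝 (∫ x in U, inner ℝ (weakGrad U w x) (A x))) :=
    tendsto_integral_bilin (innerSL ℝ) hw1.isWeakGradient.1
      (fun k => (hφ k).memLp_gradient) hA a2
  simp only [h _ (hφ _)] at t
  exact tendsto_nhds_unique t tendsto_const_nhds

theorem weakGrad_ae_eq_zero (hU : IsOpen U) {u : Euc d → ℝ} (hu : u =ᵐ[volume.restrict U] 0) :
    weakGrad U u =ᵐ[volume.restrict U] 0 := by
  refine IsWeakGradient.weakGrad_ae_eq hU ⟨MemLp.zero, fun φ _ => ?_⟩
  have : ∫ x in U, u x • gradient φ x = ∫ x in U, (0 : Euc d) := by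
    refine integral_congr_ae ?_
    filter_upwards [hu] with x hx
    simp [hx]
  simp [this]

end

/-! ### The splitting `x = (x₁, x')`, tensor products, and slices of test functions. -/

noncomputable section

variable {m : ℕ}

/-- The point `(t, y)` of `ℝ × ℝ^m`. -/
def joinPoint (t : ℝ) (y : Euc m) : Euc (m + 1) :=
  WithLp.toLp 2 (Fin.cons t y)

@[simp] theorem joinPoint_zero (t : ℝ) (y : Euc m) : joinPoint t y 0 = t := rfl

@[simp] theorem crossPart_joinPoint (t : ℝ) (y : Euc m) : crossPart (joinPoint t y) = y := rfl

@[simp] theorem joinPoint_crossPart (x : Euc (m + 1)) : joinPoint (x 0) (crossPart x) = x := by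
  ext i
  refine Fin.cases rfl (fun _ => rfl) i

theorem inner_joinPoint (t : ℝ) (y : Euc m) (v : Euc (m + 1)) :
    inner ℝ (joinPoint t y) v = t * v 0 + inner ℝ y (crossPart v) := by
  simp only [PiLp.inner_apply, Fin.sum_univ_succ, joinPoint, crossPart]
  simp [mul_comm]

theorem norm_sq_joinPoint (t : ℝ) (y : Euc m) : ‖joinPoint t y‖ ^ 2 = t ^ 2 + ‖y‖ ^ 2 := by
  rw [← real_inner_self_eq_norm_sq, inner_joinPoint, ← real_inner_self_eq_norm_sq]
  simp [sq]

theorem joinPoint_sub (s t : ℝ) (y z : Euc m) :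
    joinPoint (s - t) (y - z) = joinPoint s y - joinPoint t z := by
  ext i
  refine Fin.cases rfl (fun _ => rfl) i

theorem continuous_joinPoint : Continuous fun p : ℝ × Euc m => joinPoint p.1 p.2 := by
  refine (PiLp.continuous_toLp 2 _).comp (continuous_pi fun i => ?_)
  refine Fin.cases ?_ (fun j => ?_) i
  · exact continuous_fst
  · simp only [Fin.cons_succ]
    fun_prop

/-- The projection onto the cross section as a continuous linear map. -/
def crossPartL : Euc (m + 1) →L[ℝ] Euc m :=
  LinearMap.toContinuousLinearMap
    { toFun := crossPart, map_add' := fun _ _ => rfl, map_smul' := fun _ _ => rfl }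

/-- The inclusion of the cross section as a continuous linear map. -/
def crossIncl : Euc m →L[ℝ] Euc (m + 1) :=
  LinearMap.toContinuousLinearMap
    { toFun := joinPoint 0
      map_add' := fun x y => by
        ext i
        refine Fin.cases (by simp) (fun _ => rfl) i
      map_smul' := fun c x => by
        ext i
        refine Fin.cases (by simp) (fun _ => rfl) i }

@[simp] theorem crossPartL_apply (x : Euc (m + 1)) : crossPartL x = crossPart x := rfl

@[simp] theorem crossIncl_apply (y : Euc m) : crossIncl y = joinPoint 0 y := rfl

@[fun_prop] theorem continuous_crossPart : Continuous (crossPart (m := m)) :=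
  crossPartL.continuous

/-- The measurable equivalence `x ↦ (x₁, x')`. -/
def splitEquiv (m : ℕ) : Euc (m + 1) ≃ᵐ ℝ × Euc m where
  toFun x := (x 0, crossPart x)
  invFun p := joinPoint p.1 p.2
  left_inv x := joinPoint_crossPart x
  right_inv _ := rfl
  measurable_toFun := by
    have : Continuous fun x : Euc (m + 1) => (x 0, crossPart x) := by fun_prop
    exact this.measurable
  measurable_invFun := continuous_joinPoint.measurable

theorem splitEquiv_apply (x : Euc (m + 1)) : splitEquiv m x = (x 0, crossPart x) := rfl

theorem measurePreserving_splitEquiv : MeasurePreserving (splitEquiv m) :=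
  ((MeasurePreserving.id volume).prod (PiLp.volume_preserving_toLp (Fin m))).comp
    ((volume_preserving_piFinSuccAbove (fun _ : Fin (m + 1) => ℝ) 0).comp
      (PiLp.volume_preserving_ofLp (Fin (m + 1))))

theorem longCylinder_eq (ℓ : ℝ) (ω : Set (Euc m)) :
    longCylinder ℓ ω = splitEquiv m ⁻¹' (Set.Ioo (-ℓ) ℓ ×ˢ ω) := rfl

theorem isOpen_longCylinder {ω : Set (Euc m)} (hω : IsOpen ω) (ℓ : ℝ) :
    IsOpen (longCylinder ℓ ω) := by
  have : Continuous (splitEquiv m) := by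
    change Continuous fun x : Euc (m + 1) => (x 0, crossPart x)
    fun_prop
  exact (isOpen_Ioo.prod hω).preimage this

theorem measurePreserving_splitEquiv_restrict (ℓ : ℝ) (ω : Set (Euc m)) :
    MeasurePreserving (splitEquiv m) (volume.restrict (longCylinder ℓ ω))
      ((volume.restrict (Set.Ioo (-ℓ) ℓ)).prod (volume.restrict ω)) := by
  rw [Measure.prod_restrict, longCylinder_eq]
  exact measurePreserving_splitEquiv.restrict_preimage_emb (splitEquiv m).measurableEmbedding
    (Set.Ioo (-ℓ) ℓ ×ˢ ω)

section Tensor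

variable {F : Type*} [NormedAddCommGroup F] [NormedSpace ℝ F] {ℓ : ℝ} {ω : Set (Euc m)}
  {g : ℝ → ℝ} {h : Euc m → F}

theorem aestronglyMeasurable_tensor_prod
    (hg : AEStronglyMeasurable g (volume.restrict (Set.Ioo (-ℓ) ℓ)))
    (hh : AEStronglyMeasurable h (volume.restrict ω)) :
    AEStronglyMeasurable (fun p : ℝ × Euc m => g p.1 • h p.2)
      ((volume.restrict (Set.Ioo (-ℓ) ℓ)).prod (volume.restrict ω)) :=
  hg.comp_fst.smul hh.comp_snd

theorem aestronglyMeasurable_tensor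
    (hg : AEStronglyMeasurable g (volume.restrict (Set.Ioo (-ℓ) ℓ)))
    (hh : AEStronglyMeasurable h (volume.restrict ω)) :
    AEStronglyMeasurable (fun x : Euc (m + 1) => g (x 0) • h (crossPart x))
      (volume.restrict (longCylinder ℓ ω)) :=
  (aestronglyMeasurable_tensor_prod hg hh).comp_measurePreserving
    (measurePreserving_splitEquiv_restrict ℓ ω)

/-- Tonelli: the integral of the square factorizes over the product measure. -/
theorem eLpNorm_tensor
    (hg : AEStronglyMeasurable g (volume.restrict (Set.Ioo (-ℓ) ℓ)))
    (hh : AEStronglyMeasurable h (volume.restrict ω)) :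
    eLpNorm (fun x : Euc (m + 1) => g (x 0) • h (crossPart x)) 2
        (volume.restrict (longCylinder ℓ ω)) =
      eLpNorm g 2 (volume.restrict (Set.Ioo (-ℓ) ℓ)) * eLpNorm h 2 (volume.restrict ω) := by
  have h1 := eLpNorm_comp_measurePreserving (p := 2) (aestronglyMeasurable_tensor_prod hg hh)
    (measurePreserving_splitEquiv_restrict ℓ ω)
  refine h1.trans ?_
  simp only [eLpNorm_eq_lintegral_rpow_enorm_toReal (two_ne_zero) (ENNReal.ofNat_ne_top),
    enorm_smul, ENNReal.toReal_ofNat]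
  rw [← ENNReal.mul_rpow_of_nonneg _ _ (by norm_num), ← lintegral_prod_mul]
  · congr 2
    ext p
    rw [ENNReal.mul_rpow_of_nonneg _ _ (by norm_num)]
  · exact hg.enorm.pow_const _
  · exact hh.enorm.pow_const _

theorem memLp_tensor (hg : MemLp g 2 (volume.restrict (Set.Ioo (-ℓ) ℓ)))
    (hh : MemLp h 2 (volume.restrict ω)) :
    MemLp (fun x : Euc (m + 1) => g (x 0) • h (crossPart x)) 2
      (volume.restrict (longCylinder ℓ ω)) :=
  ⟨aestronglyMeasurable_tensor hg.1 hh.1, by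
    rw [eLpNorm_tensor hg.1 hh.1]
    exact ENNReal.mul_lt_top hg.2 hh.2⟩

/-- Fubini's theorem on the cylinder. -/
theorem setIntegral_longCylinder {k : Euc (m + 1) → ℝ}
    (hk : Integrable k (volume.restrict (longCylinder ℓ ω))) :
    ∫ x in longCylinder ℓ ω, k x =
      ∫ t in Set.Ioo (-ℓ) ℓ, ∫ y in ω, k (joinPoint t y) := by
  have hp := measurePreserving_splitEquiv_restrict ℓ ω
  have e : k = (fun p : ℝ × Euc m => k (joinPoint p.1 p.2)) ∘ splitEquiv m := by
    ext x
    simp [splitEquiv_apply]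
  rw [e, hp.integrable_comp_emb (splitEquiv m).measurableEmbedding] at hk
  rw [e]
  simp only [Function.comp_apply]
  rw [hp.integral_comp (splitEquiv m).measurableEmbedding
    (fun p : ℝ × Euc m => k (joinPoint p.1 p.2)), integral_prod _ hk]
  rfl

end Tensor

theorem gradient_tensor {g : ℝ → ℝ} {h : Euc m → ℝ} {x : Euc (m + 1)}
    (hg : DifferentiableAt ℝ g (x 0)) (hh : DifferentiableAt ℝ h (crossPart x)) :
    gradient (tensor g h) x =
      joinPoint (deriv g (x 0) * h (crossPart x)) (g (x 0) • gradient h (crossPart x)) := by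
  have h1 : HasFDerivAt (fun x : Euc (m + 1) => g (x 0))
      (deriv g (x 0) • (EuclideanSpace.proj 0 : Euc (m + 1) →L[ℝ] ℝ)) x :=
    hg.hasDerivAt.comp_hasFDerivAt x
      (EuclideanSpace.proj (𝕜 := ℝ) (0 : Fin (m + 1))).hasFDerivAt
  have h2 : HasFDerivAt (fun x : Euc (m + 1) => h (crossPart x))
      ((fderiv ℝ h (crossPart x)).comp crossPartL) x :=
    HasFDerivAt.comp x hh.hasFDerivAt crossPartL.hasFDerivAt
  have h3 := (h1.mul h2).fderiv
  refine ext_inner_right ℝ fun v => ?_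
  rw [gradient_eq_iff_inner, inner_joinPoint, inner_smul_left, gradient_eq_iff_inner]
  change fderiv ℝ ((fun x : Euc (m + 1) => g (x 0)) * fun x => h (crossPart x)) x v = _
  rw [h3]
  simp
  ring

theorem isTestFunction_tensor {ℓ : ℝ} {ω : Set (Euc m)} {g : ℝ → ℝ} {h : Euc m → ℝ}
    (hg : ContDiff ℝ (⊤ : ℕ∞) g) (hgs : HasCompactSupport g) (hgU : tsupport g ⊆ Set.Ioo (-ℓ) ℓ)
    (hh : IsTestFunction ω h) : IsTestFunction (longCylinder ℓ ω) (tensor g h) := by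
  have hK : IsCompact ((fun p : ℝ × Euc m => joinPoint p.1 p.2) '' (tsupport g ×ˢ tsupport h)) :=
    (hgs.isCompact.prod hh.2.1.isCompact).image continuous_joinPoint
  have hs : Function.support (tensor g h) ⊆
      (fun p : ℝ × Euc m => joinPoint p.1 p.2) '' (tsupport g ×ˢ tsupport h) := by
    intro x hx
    have hx' : g (x 0) * h (crossPart x) ≠ 0 := hx
    exact ⟨(x 0, crossPart x), ⟨subset_tsupport _ (left_ne_zero_of_mul hx'),
      subset_tsupport _ (right_ne_zero_of_mul hx')⟩, joinPoint_crossPart x⟩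
  refine ⟨?_, HasCompactSupport.of_support_subset_isCompact hK hs,
    (closure_minimal hs hK.isClosed).trans ?_⟩
  · exact (hg.comp (EuclideanSpace.proj (𝕜 := ℝ) (0 : Fin (m + 1))).contDiff).mul
      (hh.1.comp crossPartL.contDiff)
  · rintro _ ⟨p, ⟨h1, h2⟩, rfl⟩
    exact ⟨hgU h1, hh.2.2 h2⟩

theorem joinPoint_eq_add (t : ℝ) (y : Euc m) : joinPoint t y = joinPoint t 0 + crossIncl y := by
  ext i
  refine Fin.cases (by simp) (fun _ => ?_) i
  simp [joinPoint]

theorem gradient_slice {φ : Euc (m + 1) → ℝ} {t : ℝ} {y : Euc m}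
    (hφ : DifferentiableAt ℝ φ (joinPoint t y)) :
    gradient (fun y => φ (joinPoint t y)) y = crossPart (gradient φ (joinPoint t y)) := by
  have h1 : HasFDerivAt (fun y : Euc m => joinPoint t y) crossIncl y := by
    have : (fun y : Euc m => joinPoint t y) = fun y => joinPoint t 0 + crossIncl y := by
      ext1 y
      exact joinPoint_eq_add t y
    rw [this]
    exact crossIncl.hasFDerivAt.const_add _
  have h2 := (hφ.hasFDerivAt.comp y h1).fderiv
  refine ext_inner_right ℝ fun v => ?_
  rw [gradient_eq_iff_inner]
  change fderiv ℝ (φ ∘ fun y => joinPoint t y) y v = _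
  rw [h2, ContinuousLinearMap.comp_apply, ← gradient_eq_iff_inner, crossIncl_apply,
    real_inner_comm, inner_joinPoint, real_inner_comm]
  simp

/-- The projection of the support of `φ` is a compact subset of `ω` containing the support of every
slice. -/
theorem IsTestFunction.slice {ℓ : ℝ} {ω : Set (Euc m)} {φ : Euc (m + 1) → ℝ}
    (hφ : IsTestFunction (longCylinder ℓ ω) φ) (t : ℝ) :
    IsTestFunction ω (fun y => φ (joinPoint t y)) := by
  have hK : IsCompact (crossPart '' tsupport φ) := hφ.2.1.isCompact.image continuous_crossPart
  have hs : Function.support (fun y => φ (joinPoint t y)) ⊆ crossPart '' tsupport φ :=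
    fun y hy => ⟨joinPoint t y, subset_tsupport _ hy, crossPart_joinPoint t y⟩
  refine ⟨?_, HasCompactSupport.of_support_subset_isCompact hK hs,
    (closure_minimal hs hK.isClosed).trans ?_⟩
  · have : (fun y : Euc m => φ (joinPoint t y)) = fun y => φ (joinPoint t 0 + crossIncl y) := by
      ext1 y
      rw [← joinPoint_eq_add]
    rw [this]
    exact hφ.1.comp (contDiff_const.add crossIncl.contDiff)
  · rintro _ ⟨x, hx, rfl⟩
    exact (hφ.2.2 hx).2

theorem memLp_one_Ioo (ℓ : ℝ) :
    MemLp (fun _ : ℝ => (1 : ℝ)) 2 (volume.restrict (Set.Ioo (-ℓ) ℓ)) :=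
  memLp_const 1

/-- The weak formulation on the cross section, integrated along the axis. -/
theorem IsDirichletSolution.integral_longCylinder {ℓ : ℝ} {ω : Set (Euc m)} (hω : IsOpen ω)
    {f u : Euc m → ℝ} (hf : MemLp f 2 (volume.restrict ω)) (hu : IsDirichletSolution ω f u)
    {φ : Euc (m + 1) → ℝ} (hφ : IsTestFunction (longCylinder ℓ ω) φ) :
    ∫ x in longCylinder ℓ ω, inner ℝ (weakGrad ω u (crossPart x)) (crossPart (gradient φ x)) =
      ∫ x in longCylinder ℓ ω, f (crossPart x) * φ x := by
  have hG : MemLp (fun x => weakGrad ω u (crossPart x)) 2 (volume.restrict (longCylinder ℓ ω)) := by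
    simpa using memLp_tensor (memLp_one_Ioo ℓ) hu.1.1.isWeakGradient.1
  have hF : MemLp (fun x => f (crossPart x)) 2 (volume.restrict (longCylinder ℓ ω)) := by
    simpa using memLp_tensor (memLp_one_Ioo ℓ) hf
  have hc : MemLp (fun x => crossPart (gradient φ x)) 2 (volume.restrict (longCylinder ℓ ω)) :=
    crossPartL.comp_memLp' hφ.memLp_gradient
  have i1 : Integrable (fun x => inner ℝ (weakGrad ω u (crossPart x)) (crossPart (gradient φ x)))
      (volume.restrict (longCylinder ℓ ω)) :=
    memLp_one_iff_integrable.1 ((innerSL ℝ).memLp_of_bilin (p := 2) (q := 2) 1 hG hc)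
  have i2 : Integrable (fun x => f (crossPart x) * φ x) (volume.restrict (longCylinder ℓ ω)) :=
    hF.integrable_mul (hφ.memLp (p := 2))
  rw [setIntegral_longCylinder i1, setIntegral_longCylinder i2]
  refine integral_congr_ae (Eventually.of_forall fun t => ?_)
  -- Fubini leaves one identity for each `t`. The slice is a test function on `ω`, so it is
  -- admissible in the cross-sectional equation.
  have hs := hφ.slice t
  obtain ⟨h1, h2⟩ := hs.memH10 hω
  refine Eq.trans ?_ (hu.2 _ h1)
  refine integral_congr_ae ?_
  filter_upwards [h2] with y hy
  rw [hy, gradient_slice (hφ.1.differentiable (by simp)).differentiableAt, crossPart_joinPoint]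

end

/-! ### Smooth truncation along the axis, and tensor products in `H¹₀` of the cylinder. -/

noncomputable section

/-- A smooth function that vanishes on `(-∞, 1]` and is the identity on `[2, ∞)`. -/
def smoothRamp (s : ℝ) : ℝ := s * Real.smoothTransition (s - 1)

theorem contDiff_smoothRamp : ContDiff ℝ (⊤ : ℕ∞) smoothRamp :=
  contDiff_id.mul (Real.smoothTransition.contDiff.comp (contDiff_id.sub contDiff_const))

theorem smoothRamp_of_le {s : ℝ} (hs : s ≤ 1) : smoothRamp s = 0 := by
  simp [smoothRamp, Real.smoothTransition.zero_of_nonpos (sub_nonpos.2 hs)]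

theorem smoothRamp_of_ge {s : ℝ} (hs : 2 ≤ s) : smoothRamp s = s := by
  rw [smoothRamp, Real.smoothTransition.one_of_one_le (by linarith), mul_one]

theorem abs_smoothRamp_le (s : ℝ) : |smoothRamp s| ≤ |s| := by
  rw [smoothRamp, abs_mul, abs_of_nonneg (Real.smoothTransition.nonneg _)]
  exact mul_le_of_le_one_right (abs_nonneg s) (Real.smoothTransition.le_one _)

theorem deriv_smoothRamp_of_lt {s : ℝ} (hs : s < 1) : deriv smoothRamp s = 0 := by
  have : smoothRamp =ᶠ[𝓝 s] fun _ => 0 := by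
    filter_upwards [Iio_mem_nhds hs] with r hr using smoothRamp_of_le (le_of_lt hr)
  rw [this.deriv_eq, deriv_const]

theorem deriv_smoothRamp_of_gt {s : ℝ} (hs : 2 < s) : deriv smoothRamp s = 1 := by
  have : smoothRamp =ᶠ[𝓝 s] id := by
    filter_upwards [Ioi_mem_nhds hs] with r hr using smoothRamp_of_ge (le_of_lt hr)
  rw [this.deriv_eq, deriv_id]

/-- Off the compact interval `[1, 2]` the derivative takes only the values `0` and `1`. The uniform
bound serves as domination for the truncated derivatives. -/
theorem exists_deriv_smoothRamp_bound : ∃ C, ∀ s, |deriv smoothRamp s| ≤ C := by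
  obtain ⟨C, hC⟩ := isCompact_Icc.exists_bound_of_continuousOn (s := Set.Icc (1 : ℝ) 2)
    (contDiff_smoothRamp.continuous_deriv (by simp)).continuousOn
  refine ⟨max C 1, fun s => ?_⟩
  rcases lt_or_ge s 1 with h1 | h1
  · rw [deriv_smoothRamp_of_lt h1, abs_zero]
    exact le_max_of_le_right zero_le_one
  rcases lt_or_ge 2 s with h2 | h2
  · rw [deriv_smoothRamp_of_gt h2, abs_one]
    exact le_max_right _ _
  · exact (hC s ⟨h1, h2⟩).trans (le_max_left _ _)

/-- Dominated convergence; a constant is square integrable on a bounded interval. -/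
theorem tendsto_eLpNorm_sub_Ioo {ℓ C : ℝ} {a : ℝ → ℝ} {as : ℕ → ℝ → ℝ} (ha : Continuous a)
    (has : ∀ k, Continuous (as k)) (hC : ∀ k, ∀ t ∈ Set.Ioo (-ℓ) ℓ, |a t - as k t| ≤ C)
    (h : ∀ t ∈ Set.Ioo (-ℓ) ℓ, Tendsto (fun k => as k t) atTop (𝓝 (a t))) :
    Tendsto (fun k => eLpNorm (fun t => a t - as k t) 2 (volume.restrict (Set.Ioo (-ℓ) ℓ)))
      atTop (𝓝 0) := by
  simp only [eLpNorm_eq_lintegral_rpow_enorm_toReal (two_ne_zero) (ENNReal.ofNat_ne_top),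
    ENNReal.toReal_ofNat]
  have key : Tendsto (fun k => ∫⁻ t in Set.Ioo (-ℓ) ℓ, ‖a t - as k t‖ₑ ^ (2 : ℝ)) atTop
      (𝓝 (∫⁻ _ in Set.Ioo (-ℓ) ℓ, 0)) := by
    refine tendsto_lintegral_of_dominated_convergence (fun _ => ENNReal.ofReal C ^ (2 : ℝ))
      (fun k => ((ha.sub (has k)).measurable.enorm.pow_const _)) (fun k => ?_) ?_ ?_
    · filter_upwards [ae_restrict_mem measurableSet_Ioo] with t ht
      refine ENNReal.rpow_le_rpow ?_ (by norm_num)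
      rw [← ofReal_norm]
      exact ENNReal.ofReal_le_ofReal (hC k t ht)
    · simp only [lintegral_const]
      exact ENNReal.mul_ne_top (by simp) (by simp)
    · filter_upwards [ae_restrict_mem measurableSet_Ioo] with t ht
      have h1 : Tendsto (fun k => a t - as k t) atTop (𝓝 0) := by
        simpa using (tendsto_const_nhds (x := a t)).sub (h t ht)
      have h2 := (ENNReal.continuous_rpow_const (y := (2 : ℝ))).continuousAt.tendsto.comp
        (continuous_enorm.continuousAt.tendsto.comp h1)
      simpa [Function.comp_def] using h2
  have h2 := (ENNReal.continuous_rpow_const (y := 1 / (2 : ℝ))).continuousAt.tendsto.comp key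
  simpa [Function.comp_def] using h2

theorem memLp_Ioo {ℓ : ℝ} {a : ℝ → ℝ} (ha : Continuous a) :
    MemLp a 2 (volume.restrict (Set.Ioo (-ℓ) ℓ)) := by
  obtain ⟨C, hC⟩ := isCompact_Icc.exists_bound_of_continuousOn (s := Set.Icc (-ℓ) ℓ)
    ha.continuousOn
  refine MemLp.of_bound ha.aestronglyMeasurable C ?_
  filter_upwards [ae_restrict_mem measurableSet_Ioo] with t ht
  exact hC t (Set.Ioo_subset_Icc_self ht)

variable {m : ℕ} {ℓ : ℝ} {ω : Set (Euc m)}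

theorem tendsto_eLpNorm_tensor {F : Type*} [NormedAddCommGroup F] [NormedSpace ℝ F]
    {a : ℝ → ℝ} {as : ℕ → ℝ → ℝ} {h : Euc m → F} {hs : ℕ → Euc m → F}
    (ha : MemLp a 2 (volume.restrict (Set.Ioo (-ℓ) ℓ)))
    (has : ∀ k, MemLp (as k) 2 (volume.restrict (Set.Ioo (-ℓ) ℓ)))
    (hh : MemLp h 2 (volume.restrict ω)) (hhs : ∀ k, MemLp (hs k) 2 (volume.restrict ω))
    (h1 : Tendsto (fun k => eLpNorm (fun t => a t - as k t) 2 (volume.restrict (Set.Ioo (-ℓ) ℓ)))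
      atTop (𝓝 0))
    (h2 : Tendsto (fun k => eLpNorm (fun y => h y - hs k y) 2 (volume.restrict ω)) atTop (𝓝 0)) :
    Tendsto (fun k => eLpNorm
      (fun x : Euc (m + 1) => a (x 0) • h (crossPart x) - as k (x 0) • hs k (crossPart x)) 2
      (volume.restrict (longCylinder ℓ ω))) atTop (𝓝 0) := by
  set μ := volume.restrict (Set.Ioo (-ℓ) ℓ)
  set ν := volume.restrict ω
  have hlim : Tendsto (fun k => eLpNorm (fun t => a t - as k t) 2 μ * eLpNorm h 2 ν +
      (eLpNorm a 2 μ + eLpNorm (fun t => a t - as k t) 2 μ) * eLpNorm (fun y => h y - hs k y) 2 ν)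
      atTop (𝓝 0) := by
    have t1 := ENNReal.Tendsto.mul_const (b := eLpNorm h 2 ν) h1 (Or.inr hh.2.ne)
    have t2 := (tendsto_const_nhds (x := eLpNorm a 2 μ)).add h1
    rw [add_zero] at t2
    have t3 := ENNReal.Tendsto.mul t2 (Or.inr ENNReal.zero_ne_top) h2 (Or.inr ha.2.ne)
    simpa using t1.add t3
  refine tendsto_of_tendsto_of_tendsto_of_le_of_le tendsto_const_nhds hlim
    (fun _ => zero_le) fun k => ?_
  have d1 := ha.1.sub (has k).1
  have d2 := hh.1.sub (hhs k).1
  have e : (fun x : Euc (m + 1) =>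
      a (x 0) • h (crossPart x) - as k (x 0) • hs k (crossPart x)) =
      (fun x => (a - as k) (x 0) • h (crossPart x)) +
        fun x => as k (x 0) • (h - hs k) (crossPart x) := by
    ext x
    simp only [Pi.add_apply, Pi.sub_apply, sub_smul, smul_sub]
    abel
  rw [e]
  refine (eLpNorm_add_le (aestronglyMeasurable_tensor d1 hh.1)
    (aestronglyMeasurable_tensor (has k).1 d2) one_le_two).trans ?_
  rw [eLpNorm_tensor d1 hh.1, eLpNorm_tensor (has k).1 d2]
  refine add_le_add le_rfl (mul_le_mul_left ?_ _)
  -- Bounding `‖as k‖` by `‖a‖ + ‖a - as k‖` avoids a separate uniform bound on the approximants.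
  have : as k = a - (a - as k) := by simp
  calc eLpNorm (as k) 2 μ = eLpNorm (a - (a - as k)) 2 μ := by rw [← this]
    _ ≤ _ := eLpNorm_sub_le ha.1 d1 one_le_two

theorem norm_joinPoint_le (t : ℝ) (y : Euc m) : ‖joinPoint t y‖ ≤ ‖t‖ + ‖y‖ := by
  refine abs_le_of_sq_le_sq' ?_ (by positivity) |>.2
  rw [norm_sq_joinPoint, Real.norm_eq_abs, ← sq_abs t]
  nlinarith [abs_nonneg t, norm_nonneg y]

theorem aestronglyMeasurable_joinPoint {α : Type*} [MeasurableSpace α] {μ : Measure α}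
    {a : α → ℝ} {b : α → Euc m} (ha : AEStronglyMeasurable a μ) (hb : AEStronglyMeasurable b μ) :
    AEStronglyMeasurable (fun x => joinPoint (a x) (b x)) μ :=
  continuous_joinPoint.comp_aestronglyMeasurable (ha.prodMk hb)

theorem eLpNorm_joinPoint_le {α : Type*} [MeasurableSpace α] {μ : Measure α}
    {a : α → ℝ} {b : α → Euc m} (ha : AEStronglyMeasurable a μ) (hb : AEStronglyMeasurable b μ) :
    eLpNorm (fun x => joinPoint (a x) (b x)) 2 μ ≤ eLpNorm a 2 μ + eLpNorm b 2 μ := by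
  rw [← eLpNorm_norm a, ← eLpNorm_norm b]
  refine le_trans (eLpNorm_mono_real fun x => ?_) (eLpNorm_add_le ha.norm hb.norm one_le_two)
  exact norm_joinPoint_le _ _

theorem memLp_joinPoint {α : Type*} [MeasurableSpace α] {μ : Measure α}
    {a : α → ℝ} {b : α → Euc m} (ha : MemLp a 2 μ) (hb : MemLp b 2 μ) :
    MemLp (fun x => joinPoint (a x) (b x)) 2 μ :=
  ⟨aestronglyMeasurable_joinPoint ha.1 hb.1,
    (eLpNorm_joinPoint_le ha.1 hb.1).trans_lt (ENNReal.add_lt_top.2 ⟨ha.2, hb.2⟩)⟩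

/-- If `g` is smooth and vanishes at the ends of the cylinder, then `g ⊗ u` belongs to `H¹₀`. -/
theorem memH10_tensor (hω : IsOpen ω) {g : ℝ → ℝ} (hg : ContDiff ℝ (⊤ : ℕ∞) g)
    (hpos : ∀ t, 0 < g t → t ∈ Set.Ioo (-ℓ) ℓ)
    (hin : ∀ t ∈ Set.Ioo (-ℓ) ℓ, 0 < g t ∨ g t = 0 ∧ deriv g t = 0)
    {u : Euc m → ℝ} (hu : MemH10 ω u) :
    MemH10 (longCylinder ℓ ω) (tensor g u) ∧
      weakGrad (longCylinder ℓ ω) (tensor g u) =ᵐ[volume.restrict (longCylinder ℓ ω)]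
        fun x => joinPoint (deriv g (x 0) * u (crossPart x))
          (g (x 0) • weakGrad ω u (crossPart x)) := by
  obtain ⟨hu1, φ, hφ, a1, a2⟩ := hu
  have hG := hu1.isWeakGradient.1
  obtain ⟨C, hC⟩ := exists_deriv_smoothRamp_bound
  have hg' : Continuous (deriv g) := hg.continuous_deriv (by simp)
  let c : ℕ → ℝ := fun k => (k : ℝ) + 1
  have hc : ∀ k, 0 < c k := fun k => Nat.cast_add_one_pos k
  have hct : Tendsto c atTop atTop := tendsto_atTop_add_const_right _ _ tendsto_natCast_atTop_atTop
  -- The rescaled ramp cuts `g` off where `g ≤ 1/c` and leaves it unchanged where `g ≥ 2/c`. By the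
  -- chain rule the factors `c` and `c⁻¹` cancel, so the derivatives stay bounded as `c` grows.
  let gs : ℕ → ℝ → ℝ := fun k t => (c k)⁻¹ * smoothRamp (c k * g t)
  have hgs : ∀ k, ContDiff ℝ (⊤ : ℕ∞) (gs k) := fun k =>
    contDiff_const.mul (contDiff_smoothRamp.comp (contDiff_const.mul hg))
  have hderiv : ∀ k t, deriv (gs k) t = deriv smoothRamp (c k * g t) * deriv g t := by
    intro k t
    have h1 := (hg.differentiable (by simp) t).hasDerivAt.const_mul (c k)
    have h2 := (contDiff_smoothRamp.differentiable (by simp) (c k * g t)).hasDerivAt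
    have h3 := ((h2.comp t h1).const_mul (c k)⁻¹).deriv
    refine Eq.trans h3 ?_
    field_simp [(hc k).ne']
  -- The closed set `c g ≥ 1` contains the support, and there `g > 0`, which forces `t` into the
  -- open interval.
  have hsupp : ∀ k, tsupport (gs k) ⊆ Set.Ioo (-ℓ) ℓ := by
    intro k
    have hcl : IsClosed {t | 1 ≤ c k * g t} := isClosed_le continuous_const
      (continuous_const.mul hg.continuous)
    refine (closure_minimal (fun t ht => ?_) hcl).trans fun t ht => hpos t ?_
    · by_contra h
      refine ht ?_
      simp only [gs]
      rw [smoothRamp_of_le (not_le.1 h).le, mul_zero]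
    · exact pos_of_mul_pos_right (lt_of_lt_of_le one_pos ht) (hc k).le
  have hcs : ∀ k, HasCompactSupport (gs k) := fun k =>
    isCompact_Icc.of_isClosed_subset (isClosed_tsupport _)
      ((hsupp k).trans Set.Ioo_subset_Icc_self)
  have hev : ∀ t, 0 < g t → ∀ᶠ k in atTop, 2 < c k * g t := fun t ht =>
    (hct.atTop_mul_const ht).eventually_gt_atTop 2
  obtain ⟨C1, hC1⟩ := isCompact_Icc.exists_bound_of_continuousOn (s := Set.Icc (-ℓ) ℓ)
    hg.continuous.continuousOn
  obtain ⟨C2, hC2⟩ := isCompact_Icc.exists_bound_of_continuousOn (s := Set.Icc (-ℓ) ℓ)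
    hg'.continuousOn
  have t1 : Tendsto (fun k => eLpNorm (fun t => g t - gs k t) 2
      (volume.restrict (Set.Ioo (-ℓ) ℓ))) atTop (𝓝 0) := by
    refine tendsto_eLpNorm_sub_Ioo (C := C1 + C1) hg.continuous (fun k => (hgs k).continuous)
      (fun k t ht => ?_) fun t ht => ?_
    · have h1 : |g t| ≤ C1 := hC1 t (Set.Ioo_subset_Icc_self ht)
      have h2 : |gs k t| ≤ |g t| := by
        simp only [gs]
        rw [abs_mul, abs_inv, abs_of_pos (hc k), inv_mul_le_iff₀ (hc k)]
        refine (abs_smoothRamp_le _).trans ?_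
        rw [abs_mul, abs_of_pos (hc k)]
      exact (abs_sub _ _).trans (add_le_add h1 (h2.trans h1))
    · rcases hin t ht with h | ⟨h, -⟩
      · refine tendsto_const_nhds.congr' ?_
        filter_upwards [hev t h] with k hk
        simp only [gs]
        rw [smoothRamp_of_ge hk.le, inv_mul_cancel_left₀ (hc k).ne']
      · simp [gs, h, smoothRamp_of_le]
  have t2 : Tendsto (fun k => eLpNorm (fun t => deriv g t - deriv (gs k) t) 2
      (volume.restrict (Set.Ioo (-ℓ) ℓ))) atTop (𝓝 0) := by
    refine tendsto_eLpNorm_sub_Ioo (C := C2 + C * C2) hg'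
      (fun k => (hgs k).continuous_deriv (by simp)) (fun k t ht => ?_) fun t ht => ?_
    · have h1 : |deriv g t| ≤ C2 := hC2 t (Set.Ioo_subset_Icc_self ht)
      have h2 : |deriv (gs k) t| ≤ C * C2 := by
        rw [hderiv, abs_mul]
        exact mul_le_mul (hC _) h1 (abs_nonneg _) ((abs_nonneg _).trans (hC 0))
      exact (abs_sub _ _).trans (add_le_add h1 h2)
    -- Where `g > 0`, the truncated derivative eventually equals `g'`. Where `g = 0`, it is `0`, and
    -- the limit is right only because `g' = 0` there too.
    · rcases hin t ht with h | ⟨-, h⟩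
      · refine tendsto_const_nhds.congr' ?_
        filter_upwards [hev t h] with k hk
        rw [hderiv, deriv_smoothRamp_of_gt hk, one_mul]
      · simp [hderiv, h]
  have mg := memLp_Ioo (ℓ := ℓ) hg.continuous
  have mg' := memLp_Ioo (ℓ := ℓ) hg'
  have mgs := fun k => memLp_Ioo (ℓ := ℓ) (hgs k).continuous
  have mgs' := fun k => memLp_Ioo (ℓ := ℓ) ((hgs k).continuous_deriv (by simp))
  have mφ := fun k => (hφ k).memLp (p := 2)
  have mφ' := fun k => (hφ k).memLp_gradient (p := 2)
  refine MemH10.of_tendsto (φ := fun k => tensor (gs k) (φ k)) (isOpen_longCylinder hω ℓ)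
    (memLp_tensor mg hu1.1) (memLp_joinPoint (memLp_tensor mg' hu1.1) (memLp_tensor mg hG))
    (fun k => isTestFunction_tensor (hgs k) (hcs k) (hsupp k) (hφ k))
    (tendsto_eLpNorm_tensor mg mgs hu1.1 mφ t1 a1) ?_
  have s1 := tendsto_eLpNorm_tensor mg' mgs' hu1.1 mφ t2 a1
  have s2 := tendsto_eLpNorm_tensor mg mgs hG mφ' t1 a2
  have s3 := s1.add s2
  rw [add_zero] at s3
  refine tendsto_of_tendsto_of_tendsto_of_le_of_le tendsto_const_nhds s3
    (fun _ => zero_le) fun k => ?_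
  refine le_trans (le_of_eq ?_) (eLpNorm_joinPoint_le
    ((memLp_tensor mg' hu1.1).1.sub (memLp_tensor (mgs' k) (mφ k)).1)
    ((memLp_tensor mg hG).1.sub (memLp_tensor (mgs k) (mφ' k)).1))
  congr 1
  ext1 x
  rw [gradient_tensor ((hgs k).differentiable (by simp)).differentiableAt
    ((hφ k).1.differentiable (by simp)).differentiableAt, ← joinPoint_sub]
  rfl

end

/-! ### `L²` norms, the projection inequality and `λ₁`. -/

noncomputable section

theorem normL2_sq {d : ℕ} {F : Type*} [NormedAddCommGroup F] {U : Set (Euc d)} {g : Euc d → F}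
    (hg : MemLp g 2 (volume.restrict U)) : normL2 U g ^ 2 = ∫ x in U, ‖g x‖ ^ 2 := by
  have h := hg.eLpNorm_eq_integral_rpow_norm two_ne_zero ENNReal.ofNat_ne_top
  have h0 : 0 ≤ ∫ x in U, ‖g x‖ ^ 2 := integral_nonneg fun x => by positivity
  simp only [ENNReal.toReal_ofNat, Real.rpow_ofNat] at h
  rw [normL2, h, ENNReal.toReal_ofReal (by positivity), ← Real.rpow_natCast,
    ← Real.rpow_mul h0]
  norm_num

theorem normL2_nonneg {d : ℕ} {F : Type*} [NormedAddCommGroup F] (U : Set (Euc d))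
    (g : Euc d → F) : 0 ≤ normL2 U g := ENNReal.toReal_nonneg

theorem normL2_eq_zero {d : ℕ} {F : Type*} [NormedAddCommGroup F] {U : Set (Euc d)}
    {g : Euc d → F} (hg : g =ᵐ[volume.restrict U] 0) : normL2 U g = 0 := by
  rw [normL2, eLpNorm_congr_ae hg, eLpNorm_zero, ENNReal.toReal_zero]

theorem normL2_pos {d : ℕ} {F : Type*} [NormedAddCommGroup F] {U : Set (Euc d)}
    {g : Euc d → F} (hg : MemLp g 2 (volume.restrict U)) (h : ¬ g =ᵐ[volume.restrict U] 0) :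
    0 < normL2 U g :=
  ENNReal.toReal_pos (fun h0 => h ((eLpNorm_eq_zero_iff hg.1 two_ne_zero).1 h0)) hg.2.ne

/-- Pointwise `‖w‖² - ‖V‖² = 2⟨w, w - V⟩ - ‖w - V‖²`; the inner product integrates to `0`. -/
theorem normL2_le_of_integral_inner_sub_eq_zero {d : ℕ} {U : Set (Euc d)} {w V : Euc d → Euc d}
    (hw : MemLp w 2 (volume.restrict U)) (hV : MemLp V 2 (volume.restrict U))
    (h : ∫ x in U, inner ℝ (w x) (w x - V x) = 0) : normL2 U w ^ 2 ≤ normL2 U V ^ 2 := by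
  rw [normL2_sq hw, normL2_sq hV]
  have i1 := hw.integrable_norm_pow two_ne_zero
  have i2 := hV.integrable_norm_pow two_ne_zero
  have i3 : Integrable (fun x => inner ℝ (w x) (w x - V x)) (volume.restrict U) :=
    memLp_one_iff_integrable.1
      ((innerSL ℝ).memLp_of_bilin (p := 2) (q := 2) 1 hw (hw.sub hV))
  have key : ∫ x in U, (‖w x‖ ^ 2 - ‖V x‖ ^ 2) ≤ ∫ x in U, 2 * inner ℝ (w x) (w x - V x) := by
    refine integral_mono (i1.sub i2) (i3.const_mul 2) fun x => ?_
    have e := norm_sub_sq_real (w x) (V x)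
    simp only [inner_sub_right, real_inner_self_eq_norm_sq]
    nlinarith [sq_nonneg ‖w x - V x‖]
  rw [integral_sub i1 i2, integral_const_mul, h, mul_zero] at key
  linarith

theorem lambdaOne_nonneg {d : ℕ} (U : Set (Euc d)) : 0 ≤ lambdaOne U := by
  refine Real.sInf_nonneg ?_
  rintro r ⟨v, -, -, rfl⟩
  exact div_nonneg (normL2_nonneg _ _) (normL2_nonneg _ _)

theorem lambdaOne_le_lambdaInf {m : ℕ} {ω : Set (Euc m)} {u : Euc m → ℝ} (hu : MemH10 ω u)
    (h0 : ¬ u =ᵐ[volume.restrict ω] 0) : lambdaOne ω ≤ lambdaInf ω u := by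
  refine csInf_le ⟨0, ?_⟩ ⟨u, hu, h0, rfl⟩
  rintro r ⟨v, -, -, rfl⟩
  exact div_nonneg (normL2_nonneg _ _) (normL2_nonneg _ _)

/-! ### The profile `ψ` and its hyperbolic energy. -/

theorem contDiff_psi (ℓ a : ℝ) : ContDiff ℝ (⊤ : ℕ∞) (psi ℓ a) :=
  contDiff_const.sub ((Real.contDiff_cosh.comp (contDiff_const.mul contDiff_id)).div_const _)

theorem deriv_psi (ℓ a t : ℝ) :
    deriv (psi ℓ a) t = -(a * (Real.sinh (a * t) / Real.cosh (a * ℓ))) := by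
  have h1 : HasDerivAt (fun t => a * t) a t := by simpa using (hasDerivAt_id t).const_mul a
  have h := ((h1.cosh.div_const (Real.cosh (a * ℓ))).const_sub 1).deriv
  refine Eq.trans h ?_
  ring

theorem mem_Ioo_of_psi_pos {ℓ a t : ℝ} (hℓ : 0 < ℓ) (h : 0 < psi ℓ a t) :
    t ∈ Set.Ioo (-ℓ) ℓ := by
  rw [psi, sub_pos, div_lt_one (Real.cosh_pos _), Real.cosh_lt_cosh, abs_mul, abs_mul,
    abs_of_pos hℓ] at h
  exact abs_lt.1 (lt_of_mul_lt_mul_left h (abs_nonneg a))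

/-- The second alternative is the case `a = 0`, where the profile vanishes identically; this occurs
when `λ_∞ = 0`. -/
theorem psi_pos_or {ℓ : ℝ} (a : ℝ) {t : ℝ} (ht : t ∈ Set.Ioo (-ℓ) ℓ) :
    0 < psi ℓ a t ∨ psi ℓ a t = 0 ∧ deriv (psi ℓ a) t = 0 := by
  rcases eq_or_ne a 0 with rfl | ha
  · exact Or.inr ⟨by simp [psi], by simp [deriv_psi]⟩
  · left
    have h1 : |t| < ℓ := abs_lt.2 ht
    rw [psi, sub_pos, div_lt_one (Real.cosh_pos _), Real.cosh_lt_cosh, abs_mul, abs_mul]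
    exact mul_lt_mul_of_pos_left (h1.trans_le (le_abs_self ℓ)) (abs_pos.2 ha)

/-- The function `(sinh² + cosh²)(a t) / cosh²(a ℓ)`. -/
def hypEnergy (ℓ a t : ℝ) : ℝ :=
  (Real.sinh (a * t) / Real.cosh (a * ℓ)) ^ 2 + (Real.cosh (a * t) / Real.cosh (a * ℓ)) ^ 2

/-- Both squares are at most `1` on an interval of length `2ℓ`. Unlike the bound `2/a`, this one
survives `a = 0`. -/
theorem setIntegral_hypEnergy_le {ℓ : ℝ} (hℓ : 0 < ℓ) (a : ℝ) :
    ∫ t in Set.Ioo (-ℓ) ℓ, hypEnergy ℓ a t ≤ 4 * ℓ := by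
  have h : ∀ t ∈ Set.Ioo (-ℓ) ℓ, ‖hypEnergy ℓ a t‖ ≤ 2 := by
    intro t ht
    have hc : Real.cosh (a * t) ≤ Real.cosh (a * ℓ) := by
      rw [Real.cosh_le_cosh, abs_mul, abs_mul]
      exact mul_le_mul_of_nonneg_left ((abs_lt.2 ht).le.trans (le_abs_self ℓ)) (abs_nonneg a)
    have h1 : (Real.cosh (a * t) / Real.cosh (a * ℓ)) ^ 2 ≤ 1 := by
      refine pow_le_one₀ (div_nonneg (Real.cosh_pos _).le (Real.cosh_pos _).le) ?_
      exact (div_le_one (Real.cosh_pos _)).2 hc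
    have h2 : (Real.sinh (a * t) / Real.cosh (a * ℓ)) ^ 2 ≤
        (Real.cosh (a * t) / Real.cosh (a * ℓ)) ^ 2 := by
      rw [div_pow, div_pow]
      refine div_le_div_of_nonneg_right ?_ (by positivity)
      rw [Real.sinh_sq]
      linarith
    rw [Real.norm_eq_abs, abs_of_nonneg (by unfold hypEnergy; positivity), hypEnergy]
    linarith
  have := norm_setIntegral_le_of_norm_le_const (μ := volume) (by simp) h
  rw [Real.volume_real_Ioo_of_le (by linarith)] at this
  refine (le_abs_self _).trans (this.trans (le_of_eq ?_))
  ring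

theorem continuous_hypEnergy (ℓ a : ℝ) : Continuous (hypEnergy ℓ a) := by
  unfold hypEnergy
  exact (((Real.continuous_sinh.comp (continuous_const_mul a)).div_const _).pow 2).add
    (((Real.continuous_cosh.comp (continuous_const_mul a)).div_const _).pow 2)

/-- The integrand has the antiderivative `sinh(at)cosh(at)/(a cosh²(aℓ))`, so the integral is `2
tanh(aℓ)/a`. -/
theorem setIntegral_hypEnergy_le_div {ℓ a : ℝ} (hℓ : 0 < ℓ) (ha : 0 < a) :
    ∫ t in Set.Ioo (-ℓ) ℓ, hypEnergy ℓ a t ≤ 2 / a := by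
  have hc := Real.cosh_pos (a * ℓ)
  have hd : ∀ t ∈ Set.uIcc (-ℓ) ℓ, HasDerivAt
      (fun t => Real.sinh (a * t) * Real.cosh (a * t) / (a * Real.cosh (a * ℓ) ^ 2))
      (hypEnergy ℓ a t) t := by
    intro t _
    have h1 : HasDerivAt (fun t => a * t) a t := by simpa using (hasDerivAt_id t).const_mul a
    refine ((h1.sinh.mul h1.cosh).div_const (a * Real.cosh (a * ℓ) ^ 2)).congr_deriv ?_
    unfold hypEnergy
    field_simp
    ring
  rw [← integral_Ioc_eq_integral_Ioo, ← intervalIntegral.integral_of_le (by linarith),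
    intervalIntegral.integral_eq_sub_of_hasDerivAt hd
      ((continuous_hypEnergy ℓ a).intervalIntegrable _ _)]
  simp only [mul_neg, Real.sinh_neg, Real.cosh_neg]
  have h2 := (Real.sinh_lt_cosh (a * ℓ)).le
  rw [← sub_div, div_le_div_iff₀ (by positivity) ha]
  nlinarith [mul_le_mul_of_nonneg_left h2 (mul_pos hc ha).le]

/-! ### The energy estimate on the cylinder. -/

variable {m : ℕ} {ω : Set (Euc m)}

theorem setIntegral_longCylinder_mul (ℓ : ℝ) (ω : Set (Euc m)) (a : ℝ → ℝ) (b : Euc m → ℝ) :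
    ∫ x in longCylinder ℓ ω, a (x 0) * b (crossPart x) =
      (∫ t in Set.Ioo (-ℓ) ℓ, a t) * ∫ y in ω, b y := by
  rw [← integral_prod_mul]
  exact (measurePreserving_splitEquiv_restrict ℓ ω).integral_comp
    (splitEquiv m).measurableEmbedding (fun p : ℝ × Euc m => a p.1 * b p.2)

theorem normL2_joinPoint_tensor_sq {ℓ : ℝ} {a b : ℝ → ℝ} {u : Euc m → ℝ} {G : Euc m → Euc m}
    (ha : Continuous a) (hb : Continuous b) (hu : MemLp u 2 (volume.restrict ω))
    (hG : MemLp G 2 (volume.restrict ω)) :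
    normL2 (longCylinder ℓ ω)
        (fun x => joinPoint (a (x 0) * u (crossPart x)) (b (x 0) • G (crossPart x))) ^ 2 =
      (∫ t in Set.Ioo (-ℓ) ℓ, a t ^ 2) * normL2 ω u ^ 2 +
        (∫ t in Set.Ioo (-ℓ) ℓ, b t ^ 2) * normL2 ω G ^ 2 := by
  have m1 := memLp_tensor (memLp_Ioo (ℓ := ℓ) ha) hu
  have m2 := memLp_tensor (memLp_Ioo (ℓ := ℓ) hb) hG
  simp only [smul_eq_mul] at m1
  have i1 := m1.integrable_norm_pow two_ne_zero
  have i2 := m2.integrable_norm_pow two_ne_zero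
  rw [normL2_sq (memLp_joinPoint m1 m2), normL2_sq hu, normL2_sq hG,
    ← setIntegral_longCylinder_mul, ← setIntegral_longCylinder_mul]
  simp only [norm_smul, mul_pow, norm_mul, Real.norm_eq_abs, sq_abs] at i1 i2
  simp only [norm_sq_joinPoint, norm_smul, mul_pow, Real.norm_eq_abs, sq_abs]
  exact integral_add i1 i2

/-- The energy of `u_ℓ - ψ_ℓ(a, ·) ⊗ u_∞` is at most the energy of `(1 - ψ_ℓ(a, ·)) ⊗ u_∞`. -/
theorem normL2_weakGrad_sub_tensor_psi_sq_le (hω : IsOpen ω) {f u : Euc m → ℝ}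
    (hf : MemLp f 2 (volume.restrict ω)) (hu : IsDirichletSolution ω f u) {ℓ : ℝ} (hℓ : 0 < ℓ)
    (a : ℝ) {v : Euc (m + 1) → ℝ}
    (hv : IsDirichletSolution (longCylinder ℓ ω) (tensor (fun _ => 1) f) v) :
    MemH10 (longCylinder ℓ ω) (v - tensor (psi ℓ a) u) ∧
      normL2 (longCylinder ℓ ω) (weakGrad (longCylinder ℓ ω) (v - tensor (psi ℓ a) u)) ^ 2 ≤
        a ^ 2 * (∫ t in Set.Ioo (-ℓ) ℓ, (Real.sinh (a * t) / Real.cosh (a * ℓ)) ^ 2) *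
            normL2 ω u ^ 2 +
          (∫ t in Set.Ioo (-ℓ) ℓ, (Real.cosh (a * t) / Real.cosh (a * ℓ)) ^ 2) *
            normL2 ω (weakGrad ω u) ^ 2 := by
  have hΩ := isOpen_longCylinder hω ℓ
  obtain ⟨hT, gT⟩ := memH10_tensor hω (contDiff_psi ℓ a)
    (fun t => mem_Ioo_of_psi_pos hℓ) (fun t => psi_pos_or a) hu.1
  obtain ⟨hw, gw⟩ := hv.1.sub hΩ hT
  refine ⟨hw, ?_⟩
  have cψ := (contDiff_psi ℓ a).continuous
  have cψ' : Continuous (deriv (psi ℓ a)) := (contDiff_psi ℓ a).continuous_deriv (by simp)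
  have c1 : Continuous fun t => -deriv (psi ℓ a) t := cψ'.neg
  have c2 : Continuous fun t => 1 - psi ℓ a t := continuous_const.sub cψ
  have mG := hu.1.1.isWeakGradient.1
  -- The comparison field is `V = (-ψ' u, (1 - ψ)∇'u)`. Only its square integrability is needed,
  -- since `(1 - ψ) ⊗ u` does not vanish at the ends of the cylinder in general.
  have mV := memLp_joinPoint (memLp_tensor (memLp_Ioo (ℓ := ℓ) c1) hu.1.1.1)
    (memLp_tensor (memLp_Ioo (ℓ := ℓ) c2) mG)
  have mw := hw.1.isWeakGradient.1
  have mv := hv.1.1.isWeakGradient.1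
  have mP : MemLp (fun x => joinPoint 0 (weakGrad ω u (crossPart x))) 2
      (volume.restrict (longCylinder ℓ ω)) := by
    refine memLp_joinPoint MemLp.zero ?_
    simpa using memLp_tensor (memLp_one_Ioo ℓ) mG
  have key := normL2_le_of_integral_inner_sub_eq_zero mw mV
    (hw.integral_inner_eq_zero (mw.sub mV) fun φ hφ => ?_)
  · refine key.trans (le_of_eq ?_)
    refine (normL2_joinPoint_tensor_sq c1 c2 hu.1.1.1 mG).trans ?_
    simp only [deriv_psi, neg_neg, psi, sub_sub_cancel, mul_pow, integral_const_mul]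
  · have mφ := hφ.memLp_gradient (p := 2)
    have i1 : Integrable (fun x => inner ℝ (gradient φ x) (weakGrad (longCylinder ℓ ω) v x))
        (volume.restrict (longCylinder ℓ ω)) :=
      memLp_one_iff_integrable.1 ((innerSL ℝ).memLp_of_bilin (p := 2) (q := 2) 1 mφ mv)
    have i2 : Integrable (fun x => inner ℝ (gradient φ x)
        (joinPoint 0 (weakGrad ω u (crossPart x)))) (volume.restrict (longCylinder ℓ ω)) :=
      memLp_one_iff_integrable.1 ((innerSL ℝ).memLp_of_bilin (p := 2) (q := 2) 1 mφ mP)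
    obtain ⟨hφ1, gφ⟩ := hφ.memH10 hΩ
    have e1 : ∫ x in longCylinder ℓ ω, inner ℝ (gradient φ x) (weakGrad (longCylinder ℓ ω) v x) =
        ∫ x in longCylinder ℓ ω, f (crossPart x) * φ x := by
      have := hv.2 φ hφ1
      simp only [tensor, one_mul] at this
      rw [← this]
      refine integral_congr_ae ?_
      filter_upwards [gφ] with x hx
      rw [hx, real_inner_comm]
    have e2 : ∫ x in longCylinder ℓ ω,
        inner ℝ (gradient φ x) (joinPoint 0 (weakGrad ω u (crossPart x))) =
        ∫ x in longCylinder ℓ ω, f (crossPart x) * φ x := by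
      rw [← hu.integral_longCylinder hω hf hφ]
      refine integral_congr_ae (Eventually.of_forall fun x => ?_)
      simp only
      rw [real_inner_comm, inner_joinPoint, zero_mul, zero_add]
    -- In `∇w - V` all terms with `ψ` cancel, leaving `∇u_ℓ - (0, ∇'u)`; `e1` and `e2` say that its
    -- two parts have the same product with `∇φ`.
    rw [← sub_eq_zero.2 (e1.trans e2.symm), ← integral_sub i1 i2]
    refine integral_congr_ae ?_
    filter_upwards [gw, gT] with x h1 h2
    rw [h1, h2, ← inner_sub_right, sub_sub]
    congr 2
    ext i
    refine Fin.cases ?_ (fun j => ?_) i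
    · simp [joinPoint]
    · simp [joinPoint]
      ring

end

/-! ### The bound with `a = λ_∞`, and its failure to tend to zero. -/

theorem mainTheorem2 {m : ℕ} (ω : Set (Euc m)) (hω_open : IsOpen ω)
    (hω_bdd : Bornology.IsBounded ω) (hω_conn : IsConnected ω)
    (f : Euc m → ℝ) (hf : MemLp f 2 (volume.restrict ω))
    (uInf : Euc m → ℝ) (huInf : IsDirichletSolution ω f uInf) :
    (∀ ℓ : ℝ, 0 < ℓ → ∀ uL : Euc (m + 1) → ℝ,
      IsDirichletSolution (longCylinder ℓ ω) (tensor (fun _ => 1) f) uL →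
        MemH10 (longCylinder ℓ ω) (uL - tensor (psi ℓ (lambdaInf ω uInf)) uInf) ∧
        normL2 (longCylinder ℓ ω)
            (weakGrad (longCylinder ℓ ω) (uL - tensor (psi ℓ (lambdaInf ω uInf)) uInf)) ^ 2 ≤
          4 * (normL2 ω uInf ^ 2 +
            (1 / lambdaOne ω + 6 * ℓ * Real.exp (-2 * lambdaOne ω * ℓ)) *
              normL2 ω (weakGrad ω uInf) ^ 2)) ∧
    (¬ (uInf =ᵐ[volume.restrict ω] 0) →
      ¬ Tendsto (fun ℓ : ℝ =>
          4 * (normL2 ω uInf ^ 2 +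
            (1 / lambdaOne ω + 6 * ℓ * Real.exp (-2 * lambdaOne ω * ℓ)) *
              normL2 ω (weakGrad ω uInf) ^ 2)) atTop (𝓝 0)) := by
  have hl := lambdaOne_nonneg ω
  refine ⟨fun ℓ hℓ uL huL => ?_, fun h0 ht => ?_⟩
  · set lam := lambdaInf ω uInf with hlam
    obtain ⟨hw, hle⟩ := normL2_weakGrad_sub_tensor_psi_sq_le hω_open hf huInf hℓ lam huL
    refine ⟨hw, hle.trans ?_⟩
    set S := ∫ t in Set.Ioo (-ℓ) ℓ, (Real.sinh (lam * t) / Real.cosh (lam * ℓ)) ^ 2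
    set C := ∫ t in Set.Ioo (-ℓ) ℓ, (Real.cosh (lam * t) / Real.cosh (lam * ℓ)) ^ 2
    set N := normL2 ω uInf
    set D := normL2 ω (weakGrad ω uInf)
    have hS : 0 ≤ S := integral_nonneg fun t => by positivity
    have hD : 0 ≤ D := normL2_nonneg _ _
    have hSC : ∫ t in Set.Ioo (-ℓ) ℓ, hypEnergy ℓ lam t = S + C := by
      refine integral_add (MemLp.integrable_sq (memLp_Ioo ?_)) (MemLp.integrable_sq (memLp_Ioo ?_))
      · exact (Real.continuous_sinh.comp (continuous_const_mul lam)).div_const _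
      · exact (Real.continuous_cosh.comp (continuous_const_mul lam)).div_const _
    -- Only the inequality is needed, and it also covers `N = 0`, where the quotient is `0` by
    -- convention.
    have hlN : lam * N ≤ D := by
      change D / N * N ≤ D
      rcases eq_or_ne N 0 with h | h
      · rw [h, mul_zero]
        exact hD
      · rw [div_mul_cancel₀ _ h]
    have hlam0 : 0 ≤ lam := div_nonneg (normL2_nonneg _ _) (normL2_nonneg _ _)
    have hN : 0 ≤ N := normL2_nonneg _ _
    have hE : lam ^ 2 * S * N ^ 2 + C * D ^ 2 ≤ (S + C) * D ^ 2 := by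
      have : (lam * N) ^ 2 ≤ D ^ 2 := pow_le_pow_left₀ (mul_nonneg hlam0 hN) hlN 2
      nlinarith [mul_le_mul_of_nonneg_left this hS]
    refine hE.trans ?_
    have h4 : S + C ≤ 4 * ℓ := hSC ▸ setIntegral_hypEnergy_le hℓ lam
    -- If `λ₁ = 0`, then `1/λ₁` reads as `0` and the exponential is `1`, so the right-hand side
    -- contains `24ℓ‖∇'u‖²`, more than the `4ℓ‖∇'u‖²` required.
    rcases hl.eq_or_lt with h1 | h1
    · rw [← h1]
      simp only [div_zero, mul_zero, zero_mul, Real.exp_zero, mul_one, zero_add]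
      nlinarith [mul_le_mul_of_nonneg_right h4 (sq_nonneg D), mul_nonneg hℓ.le (sq_nonneg D)]
    -- The zero solution is no competitor in the infimum, so `λ₁ ≤ λ_∞` is available only for `u ≠
    -- 0`; for `u = 0` the energy vanishes.
    by_cases h0 : uInf =ᵐ[volume.restrict ω] 0
    · have hD0 : D = 0 := normL2_eq_zero (weakGrad_ae_eq_zero hω_open h0)
      rw [hD0]
      nlinarith [sq_nonneg N]
    · have h2 : lambdaOne ω ≤ lam := lambdaOne_le_lambdaInf huInf.1 h0
      have h3 : S + C ≤ 2 / lam := hSC ▸ setIntegral_hypEnergy_le_div hℓ (h1.trans_le h2)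
      have h5 : S + C ≤ 2 * (1 / lambdaOne ω) := by
        refine h3.trans ?_
        rw [mul_one_div]
        exact div_le_div_of_nonneg_left zero_le_two h1 h2
      have h6 : 0 ≤ 6 * ℓ * Real.exp (-2 * lambdaOne ω * ℓ) := by positivity
      -- Here `2/λ₁` already suffices against `4/λ₁`; the exponential term and `‖u‖²` are merely
      -- nonnegative.
      nlinarith [mul_le_mul_of_nonneg_right h5 (sq_nonneg D), mul_nonneg h6 (sq_nonneg D),
        mul_nonneg (one_div_nonneg.2 hl) (sq_nonneg D), sq_nonneg N]
  · have hN := normL2_pos huInf.1.1.1 h0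
    have hge : ∀ᶠ ℓ : ℝ in atTop, 4 * normL2 ω uInf ^ 2 ≤ 4 * (normL2 ω uInf ^ 2 +
        (1 / lambdaOne ω + 6 * ℓ * Real.exp (-2 * lambdaOne ω * ℓ)) *
          normL2 ω (weakGrad ω uInf) ^ 2) := by
      filter_upwards [eventually_ge_atTop 0] with ℓ hℓ
      have : 0 ≤ (1 / lambdaOne ω + 6 * ℓ * Real.exp (-2 * lambdaOne ω * ℓ)) *
          normL2 ω (weakGrad ω uInf) ^ 2 := by positivity
      linarith
    have := ge_of_tendsto ht hge
    nlinarith [pow_pos hN 2]
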